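/- Let $\mathfrak g$ be a finite-dimensional solvable real Lie algebra with an invariant scalar product $\langle\cdot,\cdot\rangle$, that is, a non-degenerate (possibly indefinite) symmetric bilinear form satisfying $\langle[x,y],z\rangle=-\langle y,[x,z]\rangle$ for all $x,y,z\in\mathfrak g$. Let $s$ be its Witt index, i.e. the maximal dimension of a totally isotropic subspace, and let $\mathfrak n$ be the nilradical of $\mathfrak g$, i.e. its largest nilpotent ideal. The scalar product is called Einstein if the left-invariant pseudo-Riemannian metric that it defines on a Lie group with Lie algebra $\mathfrak g$ satisfies $\mathrm{Ric}=c\,\langle\cdot,\cdot\rangle$ for some constant $c\in\mathbb R$. Then: (1) $\langle\cdot,\cdot\rangle$ is Einstein if and only if the Killing form of $\mathfrak g$ vanishes. (2) If $\langle\cdot,\cdot\rangle$ is Einstein and $\mathfrak g$ is not nilpotent, then $\dim\mathfrak g\geq 6$, $\dim\mathfrak n\geq 5$ and $s\geq 2$. (3) The bounds in (2) are sharp: let $\mathfrak g$ be the real Lie algebra with basis $a,b,x_1,x_2,y,z$ and non-zero brackets (up to skew-symmetry) $$[a,b]=b,\quad [a,x_1]=x_2,\quad [a,x_2]=-x_1,\quad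 [a,y]=-y,\quad [b,y]=z,\quad [x_1,x_2]=z,$$ with the symmetric bilinear form given by $\langle a,z\rangle=\langle b,y\rangle=\langle x_1,x_1\rangle=\langle x_2,x_2\rangle=1$, all other products of basis vectors (up to symmetry) being $0$. Then $\mathfrak g$ is solvable and not nilpotent, $\langle\cdot,\cdot\rangle$ is an invariant Einstein scalar product, and $\dim\mathfrak g=6$, $\dim\mathfrak n=5$, $s=2$. -/

import Mathlib

/-! ### Metric Lie algebras -/

/-- An invariant scalar product on a real Lie algebra: a nondegenerate symmetric bilinear form `B`
with `B ⁅x, y⁆ z = - B y ⁅x, z⁆`. It may be indefinite. -/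
structure IsInvariantScalarProduct {𝔤 : Type*} [LieRing 𝔤] [LieAlgebra ℝ 𝔤]
    (B : LinearMap.BilinForm ℝ 𝔤) : Prop where
  symm : B.IsSymm
  nondegenerate : B.Nondegenerate
  invariant : ∀ x y z : 𝔤, B ⁅x, y⁆ z = - B y ⁅x, z⁆

/-- A subspace `W` is totally isotropic if the form vanishes identically on `W`. -/
def IsTotallyIsotropic {V : Type*} [AddCommGroup V] [Module ℝ V]
    (B : LinearMap.BilinForm ℝ V) (W : Submodule ℝ V) : Prop :=
  ∀ x ∈ W, ∀ y ∈ W, B x y = 0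

/-- The Witt index: the maximal dimension of a totally isotropic subspace. -/
noncomputable def wittIndex {V : Type*} [AddCommGroup V] [Module ℝ V]
    (B : LinearMap.BilinForm ℝ V) : ℕ :=
  sSup {d : ℕ | ∃ W : Submodule ℝ V, IsTotallyIsotropic B W ∧ Module.finrank ℝ W = d}

/-- In finite dimension the supremum in the definition of the Witt index is a maximum. -/
theorem wittIndex_isGreatest {V : Type*} [AddCommGroup V] [Module ℝ V] [FiniteDimensional ℝ V]
    (B : LinearMap.BilinForm ℝ V) :
    IsGreatest {d : ℕ | ∃ W : Submodule ℝ V, IsTotallyIsotropic B W ∧ Module.finrank ℝ W = d}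
      (wittIndex B) := by
  have hne : {d : ℕ | ∃ W : Submodule ℝ V,
      IsTotallyIsotropic B W ∧ Module.finrank ℝ W = d}.Nonempty := by
    refine ⟨0, ⊥, ?_, finrank_bot ℝ V⟩
    intro x hx y _
    rw [(Submodule.mem_bot ℝ).1 hx]
    simp
  have hbdd : BddAbove {d : ℕ | ∃ W : Submodule ℝ V,
      IsTotallyIsotropic B W ∧ Module.finrank ℝ W = d} := by
    refine ⟨Module.finrank ℝ V, ?_⟩
    rintro d ⟨W, _, rfl⟩
    exact Submodule.finrank_le W
  exact ⟨Nat.sSup_mem hne hbdd, fun d hd => le_csSup hbdd hd⟩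

/-- The nilradical: the largest nilpotent ideal, i.e. the sum of all ideals that are nilpotent
as Lie algebras. (Mathlib's `LieAlgebra.maxNilpotentIdeal` is a different object: it is the largest
ideal that is nilpotent as a module over the whole Lie algebra.) -/
def lieNilradical (𝔤 : Type*) [LieRing 𝔤] [LieAlgebra ℝ 𝔤] : LieIdeal ℝ 𝔤 :=
  sSup {I : LieIdeal ℝ 𝔤 | LieRing.IsNilpotent I}

/-! ### Einstein scalar products

A scalar product on the Lie algebra `𝔤` of a Lie group `G` extends to a left-invariant
pseudo-Riemannian metric on `G`. Its Levi-Civita connection, curvature tensor and Ricci tensor are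
left-invariant, so they are given by multilinear maps on `𝔤`. -/

/-- `D x y`, read as `∇_x y` on left-invariant vector fields, is the Levi-Civita connection of the
left-invariant metric given by `B`: it is torsion-free and compatible with the metric. -/
structure IsLeviCivita {𝔤 : Type*} [LieRing 𝔤] [LieAlgebra ℝ 𝔤]
    (B : LinearMap.BilinForm ℝ 𝔤) (D : 𝔤 →ₗ[ℝ] 𝔤 →ₗ[ℝ] 𝔤) : Prop where
  torsion_free : ∀ x y : 𝔤, D x y - D y x = ⁅x, y⁆
  metric : ∀ x y z : 𝔤, B (D x y) z + B y (D x z) = 0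

/-- The curvature tensor in the form `(z, y) ↦ (x ↦ R(x, y) z)`, where
`R(x, y) z = ∇_x ∇_y z - ∇_y ∇_x z - ∇_[x, y] z`. -/
def curvatureEnd {𝔤 : Type*} [LieRing 𝔤] [LieAlgebra ℝ 𝔤]
    (D : 𝔤 →ₗ[ℝ] 𝔤 →ₗ[ℝ] 𝔤) (y z : 𝔤) : 𝔤 →ₗ[ℝ] 𝔤 where
  toFun x := D x (D y z) - D y (D x z) - D ⁅x, y⁆ z
  map_add' x x' := by
    simp only [map_add, LinearMap.add_apply, add_lie]
    abel
  map_smul' c x := by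
    simp only [map_smul, LinearMap.smul_apply, smul_lie, RingHom.id_apply, smul_sub]

/-- The Ricci tensor `Ric(y, z) = tr (x ↦ R(x, y) z)`. -/
noncomputable def ricciTensor {𝔤 : Type*} [LieRing 𝔤] [LieAlgebra ℝ 𝔤]
    (D : 𝔤 →ₗ[ℝ] 𝔤 →ₗ[ℝ] 𝔤) (y z : 𝔤) : ℝ :=
  LinearMap.trace ℝ 𝔤 (curvatureEnd D y z)

/-- The scalar product `B` is Einstein if the left-invariant metric that it defines is an Einstein
metric: `Ric = c • B` for some real constant `c`, where `Ric` is computed from the Levi-Civita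
connection. -/
def IsEinstein {𝔤 : Type*} [LieRing 𝔤] [LieAlgebra ℝ 𝔤] (B : LinearMap.BilinForm ℝ 𝔤) : Prop :=
  ∃ D : 𝔤 →ₗ[ℝ] 𝔤 →ₗ[ℝ] 𝔤, IsLeviCivita B D ∧ ∃ c : ℝ, ∀ y z : 𝔤, ricciTensor D y z = c * B y z

/-- The Levi-Civita connection of a nondegenerate symmetric form is unique. -/
theorem IsLeviCivita.unique {𝔤 : Type*} [LieRing 𝔤] [LieAlgebra ℝ 𝔤]
    {B : LinearMap.BilinForm ℝ 𝔤} (hs : B.IsSymm) (hn : B.Nondegenerate)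
    {D D' : 𝔤 →ₗ[ℝ] 𝔤 →ₗ[ℝ] 𝔤} (hD : IsLeviCivita B D) (hD' : IsLeviCivita B D') : D = D' := by
  have koszul : ∀ {E : 𝔤 →ₗ[ℝ] 𝔤 →ₗ[ℝ] 𝔤}, IsLeviCivita B E → ∀ x y z : 𝔤,
      2 * B (E x y) z = B ⁅x, y⁆ z - B ⁅y, z⁆ x + B ⁅z, x⁆ y := by
    intro E hE x y z
    rw [← hE.torsion_free x y, ← hE.torsion_free y z, ← hE.torsion_free z x]
    simp only [map_sub, LinearMap.sub_apply]
    have h1 := hE.metric x y z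
    have h2 := hE.metric y z x
    have h3 := hE.metric z x y
    rw [hs.eq y (E x z)] at h1
    rw [hs.eq z (E y x)] at h2
    rw [hs.eq x (E z y)] at h3
    linarith
  ext x y
  refine sub_eq_zero.1 (hn.1 _ fun z => ?_)
  have h1 := koszul hD x y z
  have h2 := koszul hD' x y z
  simp only [map_sub, LinearMap.sub_apply]
  linarith

/-! ### The six-dimensional example -/

/-- The real vector space with basis `a, b, x₁, x₂, y, z`; the coordinates of a vector are numbered
`0, …, 5` in this order. It carries the Lie bracket of the double extension of the abelian algebra
on `b, x₁, x₂, y` by `a`, where `a` acts by the derivation `δ` with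
`δ b = b`, `δ x₁ = x₂`, `δ x₂ = -x₁`, `δ y = -y`. So the nonzero brackets of basis vectors are
`⁅a, b⁆ = b`, `⁅a, x₁⁆ = x₂`, `⁅a, x₂⁆ = -x₁`, `⁅a, y⁆ = -y`, `⁅b, y⁆ = z`, `⁅x₁, x₂⁆ = z`. -/
def DoubleExt6 : Type := Fin 6 → ℝ

namespace DoubleExt6

instance : AddCommGroup DoubleExt6 := inferInstanceAs (AddCommGroup (Fin 6 → ℝ))

noncomputable instance : Module ℝ DoubleExt6 := inferInstanceAs (Module ℝ (Fin 6 → ℝ))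

instance : FiniteDimensional ℝ DoubleExt6 := inferInstanceAs (FiniteDimensional ℝ (Fin 6 → ℝ))

/-- The Lie bracket in coordinates. -/
noncomputable def br (u v : Fin 6 → ℝ) : Fin 6 → ℝ :=
  ![0,
    u 0 * v 1 - v 0 * u 1,
    -(u 0 * v 3 - v 0 * u 3),
    u 0 * v 2 - v 0 * u 2,
    -(u 0 * v 4 - v 0 * u 4),
    (u 1 * v 4 - v 1 * u 4) + (u 2 * v 3 - v 2 * u 3)]

noncomputable instance : LieRing DoubleExt6 where
  bracket u v := br u v
  add_lie u v w := by
    change br (fun i => u i + v i) w = fun i => br u w i + br v w i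
    funext i
    fin_cases i <;> simp [br] <;> ring
  lie_add u v w := by
    change br u (fun i => v i + w i) = fun i => br u v i + br u w i
    funext i
    fin_cases i <;> simp [br] <;> ring
  lie_self u := by
    change br u u = fun _ => 0
    funext i
    fin_cases i <;> simp [br]
  leibniz_lie u v w := by
    change br u (br v w) = fun i => br (br u v) w i + br v (br u w) i
    funext i
    fin_cases i <;> simp [br] <;> ring

noncomputable instance : LieAlgebra ℝ DoubleExt6 where
  lie_smul c u v := by
    change br u (fun i => c * v i) = fun i => c * br u v i
    funext i
    fin_cases i <;> simp [br] <;> ring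

/-- The scalar product in coordinates. -/
noncomputable def sp (u v : Fin 6 → ℝ) : ℝ :=
  (u 0 * v 5 + u 5 * v 0) + (u 1 * v 4 + u 4 * v 1) + u 2 * v 2 + u 3 * v 3

/-- The scalar product for which `a, z` and `b, y` are dual isotropic pairs, `x₁, x₂` are
orthonormal, and the three planes spanned by these pairs are mutually orthogonal. -/
noncomputable def form : LinearMap.BilinForm ℝ DoubleExt6 :=
  LinearMap.mk₂ ℝ (fun u v : DoubleExt6 => sp u v)
    (fun u u' v => by
      change sp (fun i => u i + u' i) v = sp u v + sp u' v
      simp only [sp]; ring)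
    (fun c u v => by
      change sp (fun i => c * u i) v = c * sp u v
      simp only [sp]; ring)
    (fun u v v' => by
      change sp u (fun i => v i + v' i) = sp u v + sp u v'
      simp only [sp]; ring)
    (fun c u v => by
      change sp u (fun i => c * v i) = c * sp u v
      simp only [sp]; ring)

end DoubleExt6

/-! Invariance forces `∇_x y = ½[x, y]`, whence `Ric = -¼ K` with `K` the Killing form, and Einstein
means `K = c • B`. If `c ≠ 0`, `K` is nondegenerate and the algebra semisimple; being solvable it is
zero, so `K = 0` in every case.

Let `K = 0`. Without nilpotency, Engel's theorem gives `x` with `T = ad x` not nilpotent; `T` is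
skew and `tr T² = K(x, x) = 0`. In the orthogonal Fitting decomposition `V₀ ⊕ V₁`, these two
conditions force `dim V₁ ≥ 4` and an isotropic `v ≠ 0` in `V₁` (`exists_fitting_of_skew`). Let `m`
be the derived algebra plus the center and `j = m^⊥`. Then `j` is central, so it lies in `m` and in
`V₀`, while `V₁ ≤ range T ≤ m`. By Cartan's criterion `m` consists of ad-nilpotent elements and lies
in the nilradical; thus `x ∉ m` and `dim j = dim 𝔤 - dim m ≥ 1`. So `dim m ≥ dim j + dim V₁ ≥ 5`,
`dim 𝔤 ≥ 6`, and `j + ℝv` is totally isotropic of dimension at least 2. -/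

open Module

/-! ### Skew endomorphisms and their Fitting decomposition -/

/-- An endomorphism that is skew for a nondegenerate form is conjugate to minus its transpose. -/
theorem toDual_conj_of_skew {W : Type*} [AddCommGroup W] [Module ℝ W] [FiniteDimensional ℝ W]
    {B : LinearMap.BilinForm ℝ W} (hn : B.Nondegenerate)
    {S : W →ₗ[ℝ] W} (hS : ∀ u v, B (S u) v = - B u (S v)) :
    (B.toDual hn).conj S = -S.dualMap := by
  ext φ w
  have h : B ((B.toDual hn).symm φ) (S w) = φ (S w) :=
    LinearMap.BilinForm.apply_toDual_symm_apply φ (S w)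
  simp [LinearEquiv.conj_apply, LinearMap.BilinForm.toDual_def, hS, h]

theorem trace_eq_zero_of_skew {W : Type*} [AddCommGroup W] [Module ℝ W] [FiniteDimensional ℝ W]
    {B : LinearMap.BilinForm ℝ W} (hn : B.Nondegenerate)
    {S : W →ₗ[ℝ] W} (hS : ∀ u v, B (S u) v = - B u (S v)) : LinearMap.trace ℝ W S = 0 := by
  have h := congrArg (LinearMap.trace ℝ _) (toDual_conj_of_skew hn hS)
  have h' : LinearMap.trace ℝ _ S.dualMap = LinearMap.trace ℝ W S := LinearMap.trace_transpose' S
  rw [LinearMap.trace_conj', ← neg_one_smul ℝ S.dualMap, map_smul, h', smul_eq_mul] at h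
  linarith

/-- Similarity of `S` to minus its transpose gives `det S = (-1)^dim · det S`, with `det S ≠ 0`. -/
theorem even_finrank_of_skew_of_injective {W : Type*} [AddCommGroup W] [Module ℝ W]
    [FiniteDimensional ℝ W] {B : LinearMap.BilinForm ℝ W} (hn : B.Nondegenerate)
    {S : W →ₗ[ℝ] W} (hS : ∀ u v, B (S u) v = - B u (S v)) (hinj : Function.Injective S) :
    Even (finrank ℝ W) := by
  have h := congrArg LinearMap.det (toDual_conj_of_skew hn hS)
  rw [LinearEquiv.conj_apply, LinearMap.comp_assoc, LinearMap.det_conj, ← neg_one_smul ℝ S.dualMap, LinearMap.det_smul,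
    LinearMap.det_dualMap, Subspace.dual_finrank_eq] at h
  have hd : LinearMap.det S ≠ 0 := by
    have := LinearMap.isUnit_iff_ker_eq_bot S |>.2 (LinearMap.ker_eq_bot.2 hinj)
    exact ((LinearMap.isUnit_iff_isUnit_det S).1 this).ne_zero
  by_contra hodd
  rw [Nat.not_even_iff_odd] at hodd
  rw [hodd.neg_one_pow] at h
  exact hd (by linarith)

theorem trace_mul_self_of_finrank_eq_two {W : Type*} [AddCommGroup W] [Module ℝ W]
    [FiniteDimensional ℝ W] (h2 : finrank ℝ W = 2) (S : W →ₗ[ℝ] W) :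
    LinearMap.trace ℝ W (S * S) = LinearMap.trace ℝ W S ^ 2 - 2 * LinearMap.det S := by
  let b := finBasisOfFinrankEq ℝ W h2
  rw [LinearMap.trace_eq_matrix_trace ℝ b, LinearMap.trace_eq_matrix_trace ℝ b,
    ← LinearMap.det_toMatrix b, LinearMap.toMatrix_mul]
  generalize LinearMap.toMatrix b b S = M
  simp only [Matrix.trace_fin_two, Matrix.det_fin_two, Matrix.mul_apply, Fin.sum_univ_two]
  ring

/-- The dimension is even and positive. Dimension 2 is excluded because `tr S = 0` would give `tr S²
= -2 det S ≠ 0`. -/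
theorem four_le_finrank_of_skew {W : Type*} [AddCommGroup W] [Module ℝ W]
    [FiniteDimensional ℝ W] [Nontrivial W] {B : LinearMap.BilinForm ℝ W} (hn : B.Nondegenerate)
    {S : W →ₗ[ℝ] W} (hS : ∀ u v, B (S u) v = - B u (S v)) (hinj : Function.Injective S)
    (htr : LinearMap.trace ℝ W (S * S) = 0) : 4 ≤ finrank ℝ W := by
  obtain ⟨k, hk⟩ := even_finrank_of_skew_of_injective hn hS hinj
  have hpos : 0 < finrank ℝ W := finrank_pos
  have h2 : finrank ℝ W ≠ 2 := fun h2 => by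
    rw [trace_mul_self_of_finrank_eq_two h2, trace_eq_zero_of_skew hn hS] at htr
    have := LinearMap.isUnit_iff_ker_eq_bot S |>.2 (LinearMap.ker_eq_bot.2 hinj)
    exact ((LinearMap.isUnit_iff_isUnit_det S).1 this).ne_zero (by linarith)
  omega

/-- A real symmetric form without isotropic vectors is definite. -/
theorem mul_self_pos_of_anisotropic {W : Type*} [AddCommGroup W] [Module ℝ W]
    {B : LinearMap.BilinForm ℝ W} (hs : B.IsSymm) (ha : ∀ v, B v v = 0 → v = 0)
    {u w : W} (hu : u ≠ 0) (hw : w ≠ 0) : 0 < B u u * B w w := by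
  by_contra! hle
  have hu' : B u u ≠ 0 := fun h => hu (ha u h)
  have hw' : B w w ≠ 0 := fun h => hw (ha w h)
  have hlt : B u u * B w w < 0 := lt_of_le_of_ne hle (mul_ne_zero hu' hw')
  -- Opposite signs give `t ↦ B(u + tw, u + tw)` a real root; anisotropy then makes `u` a multiple
  -- of `w`, so the signs agree after all.
  have hd : 0 ≤ discrim (B w w) (2 * B u w) (B u u) := by
    rw [discrim]; nlinarith [sq_nonneg (B u w)]
  obtain ⟨t, ht⟩ := exists_quadratic_eq_zero hw'
    ⟨Real.sqrt (discrim (B w w) (2 * B u w) (B u u)), (Real.mul_self_sqrt hd).symm⟩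
  have h0 : u + t • w = 0 := ha _ <| by
    have := hs.eq u w
    simp only [map_add, LinearMap.add_apply, map_smul, LinearMap.smul_apply, smul_eq_mul] at this ⊢
    rw [← ht, ← this]; ring
  rw [eq_neg_of_add_eq_zero_left h0] at hlt
  simp only [map_neg, LinearMap.neg_apply, map_smul, LinearMap.smul_apply, smul_eq_mul] at hlt
  nlinarith [sq_nonneg (t * B w w)]

/-- Otherwise the form is definite, and in an orthogonal basis the diagonal entries of `S²` are
`-B(Sv, Sv) / B(v, v) < 0`, contradicting `tr S² = 0`. -/
theorem exists_isotropic_of_skew {W : Type*} [AddCommGroup W] [Module ℝ W]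
    [FiniteDimensional ℝ W] [Nontrivial W] {B : LinearMap.BilinForm ℝ W} (hs : B.IsSymm)
    {S : W →ₗ[ℝ] W} (hS : ∀ u v, B (S u) v = - B u (S v)) (hinj : Function.Injective S)
    (htr : LinearMap.trace ℝ W (S * S) = 0) : ∃ v, v ≠ 0 ∧ B v v = 0 := by
  by_contra! hne
  have ha : ∀ v, B v v = 0 → v = 0 := fun v hv => by
    by_contra h
    exact hne v h hv
  obtain ⟨v, hv⟩ := LinearMap.BilinForm.exists_orthogonal_basis (B := B) ⟨hs.eq⟩
  have hrepr : ∀ w i, v.repr w i * B (v i) (v i) = B w (v i) := fun w i => by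
    conv_rhs => rw [← v.sum_repr w]
    rw [map_sum, LinearMap.sum_apply, Finset.sum_eq_single i]
    · simp
    · intro j _ hji
      have : B (v j) (v i) = 0 := hv hji
      simp [this]
    · simp
  have : Nonempty (Fin (finrank ℝ W)) := ⟨⟨0, finrank_pos⟩⟩
  have hlt : LinearMap.trace ℝ W (S * S) < 0 := by
    rw [LinearMap.trace_eq_matrix_trace ℝ v, Matrix.trace]
    refine Finset.sum_neg (fun i _ => ?_) Finset.univ_nonempty
    have h1 := hrepr ((S * S) (v i)) i
    have h2 := mul_self_pos_of_anisotropic hs ha (v.ne_zero i)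
      ((map_ne_zero_iff S hinj).2 (v.ne_zero i))
    rw [Module.End.mul_apply, hS] at h1
    rw [Matrix.diag_apply, LinearMap.toMatrix_apply, Module.End.mul_apply]
    by_contra! hle
    have h3 := mul_nonneg hle (sq_nonneg (B (v i) (v i)))
    rw [sq, ← mul_assoc, h1] at h3
    linarith
  exact hlt.ne htr

theorem trace_eq_add_of_isCompl {V : Type*} [AddCommGroup V] [Module ℝ V] [FiniteDimensional ℝ V]
    {p q : Submodule ℝ V} (hc : IsCompl p q) {f : V →ₗ[ℝ] V} (hp : ∀ w ∈ p, f w ∈ p)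
    (hq : ∀ w ∈ q, f w ∈ q) :
    LinearMap.trace ℝ V f =
      LinearMap.trace ℝ p (f.restrict hp) + LinearMap.trace ℝ q (f.restrict hq) := by
  have hint : DirectSum.IsInternal (fun b : Bool => cond b p q) := by
    rw [DirectSum.isInternal_submodule_iff_isCompl _ (i := true) (j := false) (by simp)
      (by ext b; cases b <;> simp)]
    exact hc
  have hmaps : ∀ b : Bool, Set.MapsTo f (cond b p q : Submodule ℝ V)
      (cond b p q : Submodule ℝ V) := by
    rintro (_ | _)
    · exact hq
    · exact hp
  rw [LinearMap.trace_eq_sum_trace_restrict hint hmaps, Fintype.sum_bool]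
  rfl

/-- The Fitting decomposition of a skew endomorphism `T` with `tr T² = 0` that is not nilpotent. -/
theorem exists_fitting_of_skew {V : Type*} [AddCommGroup V] [Module ℝ V]
    [FiniteDimensional ℝ V] {B : LinearMap.BilinForm ℝ V} (hs : B.IsSymm) (hn : B.Nondegenerate)
    {T : Module.End ℝ V} (hT : ∀ u v, B (T u) v = - B u (T v)) (hnil : ¬ IsNilpotent T)
    (htr : LinearMap.trace ℝ V (T * T) = 0) :
    ∃ V₀ V₁ : Submodule ℝ V, Disjoint V₀ V₁ ∧ (∀ u ∈ V₀, ∀ v ∈ V₁, B u v = 0) ∧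
      LinearMap.ker T ≤ V₀ ∧ V₁ ≤ LinearMap.range T ∧ 4 ≤ finrank ℝ V₁ ∧
      ∃ v ∈ V₁, v ≠ 0 ∧ B v v = 0 := by
  obtain ⟨N, hN⟩ := Filter.eventually_atTop.1 T.eventually_isCompl_ker_pow_range_pow
  -- The exponent must be positive for `ker T ≤ ker Tⁿ` and `range Tⁿ ≤ range T`.
  set n := N + 1 with hn1
  have hc := hN n (by omega)
  set V₀ := LinearMap.ker (T ^ n)
  set V₁ := LinearMap.range (T ^ n)
  have hpow : ∀ k u v, B ((T ^ k) u) v = (-1) ^ k * B u ((T ^ k) v) := by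
    intro k
    induction k with
    | zero => simp
    | succ k ih =>
      intro u v
      have h : (T ^ (k + 1)) v = T ((T ^ k) v) := by rw [pow_succ', Module.End.mul_apply]
      rw [h, pow_succ, Module.End.mul_apply, ih, hT]
      ring
  have horth : ∀ u ∈ V₀, ∀ v ∈ V₁, B u v = 0 := by
    rintro u hu _ ⟨v, rfl⟩
    have h := hpow n u v
    rw [LinearMap.mem_ker.1 hu] at h
    simpa using h.symm
  have hker : LinearMap.ker T ≤ V₀ := fun u hu => by
    rw [LinearMap.mem_ker, hn1, pow_succ, Module.End.mul_apply, LinearMap.mem_ker.1 hu, map_zero]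
  have hrange : V₁ ≤ LinearMap.range T := by
    rintro _ ⟨v, rfl⟩
    exact ⟨(T ^ N) v, by rw [hn1, pow_succ', Module.End.mul_apply]⟩
  have hcomm : ∀ w, (T ^ n) (T w) = T ((T ^ n) w) := fun w => by
    rw [← Module.End.mul_apply, ← Module.End.mul_apply, ← pow_succ, ← pow_succ']
  have hT₀ : ∀ w ∈ V₀, T w ∈ V₀ := fun w hw => by
    rw [LinearMap.mem_ker, hcomm, LinearMap.mem_ker.1 hw, map_zero]
  have hT₁ : ∀ w ∈ V₁, T w ∈ V₁ := by
    rintro _ ⟨w, rfl⟩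
    exact ⟨T w, hcomm w⟩
  have hnt : Nontrivial V₁ := by
    rw [Submodule.nontrivial_iff_ne_bot]
    intro h
    exact hnil ⟨n, LinearMap.range_eq_bot.1 h⟩
  let S : V₁ →ₗ[ℝ] V₁ := T.restrict hT₁
  have hinj : Function.Injective S := by
    rw [← LinearMap.ker_eq_bot, LinearMap.ker_eq_bot']
    intro w hw
    have hw' : T w = 0 := congrArg Subtype.val hw
    exact Subtype.ext (Submodule.disjoint_def.1 hc.disjoint w (hker hw') w.2)
  have hS : ∀ u v, B.restrict V₁ (S u) v = - B.restrict V₁ u (S v) := fun u v => hT u v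
  have hs' : (B.restrict V₁).IsSymm := ⟨fun u v => hs.eq u v⟩
  have hn' : (B.restrict V₁).Nondegenerate := by
    refine hs'.isRefl.nondegenerate_iff_separatingLeft.2 fun u hu => ?_
    refine Subtype.ext (hn.1 _ fun y => ?_)
    obtain ⟨y₀, h₀, y₁, h₁, rfl⟩ := Submodule.mem_sup.1
      (hc.sup_eq_top ▸ Submodule.mem_top : y ∈ V₀ ⊔ V₁)
    have e₀ : B u y₀ = 0 := by rw [← hs.eq]; exact horth _ h₀ _ u.2
    have e₁ : B u y₁ = 0 := hu ⟨y₁, h₁⟩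
    rw [map_add, e₀, e₁, add_zero]
  have htr' : LinearMap.trace ℝ V₁ (S * S) = 0 := by
    have h := trace_eq_add_of_isCompl hc (f := T * T)
      (fun w hw => hT₀ _ (hT₀ w hw) : ∀ w ∈ V₀, (T * T) w ∈ V₀)
      (fun w hw => hT₁ _ (hT₁ w hw) : ∀ w ∈ V₁, (T * T) w ∈ V₁)
    have hnil₀ : IsNilpotent ((T * T).restrict
        (fun w hw => hT₀ _ (hT₀ w hw) : ∀ w ∈ V₀, (T * T) w ∈ V₀)) := by
      refine ⟨n, LinearMap.ext fun w => Subtype.ext ?_⟩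
      rw [Module.End.pow_restrict, LinearMap.restrict_apply]
      have hw : (T ^ n) (w : V) = 0 := w.2
      change ((T * T) ^ n) (w : V) = 0
      rw [(Commute.refl T).mul_pow, Module.End.mul_apply, hw, map_zero]
    rw [htr, (LinearMap.isNilpotent_trace_of_isNilpotent hnil₀).eq_zero, zero_add] at h
    exact h.symm
  obtain ⟨v, hv, hv0⟩ := exists_isotropic_of_skew hs' hS hinj htr'
  exact ⟨V₀, V₁, hc.disjoint, horth, hker, hrange, four_le_finrank_of_skew hn' hS hinj htr',
    v, v.2, fun h => hv (Subtype.ext h), hv0⟩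

/-! ### The Ricci tensor of an invariant scalar product -/

section LeviCivita

variable {𝔤 : Type*} [LieRing 𝔤] [LieAlgebra ℝ 𝔤]

/-- The Levi-Civita connection of an invariant scalar product is `∇_x y = ½ [x, y]`. -/
theorem IsInvariantScalarProduct.isLeviCivita {B : LinearMap.BilinForm ℝ 𝔤}
    (hB : IsInvariantScalarProduct B) :
    IsLeviCivita B ((1 / 2 : ℝ) • (LieAlgebra.ad ℝ 𝔤 : 𝔤 →ₗ[ℝ] 𝔤 →ₗ[ℝ] 𝔤)) where
  torsion_free x y := by
    simp only [LinearMap.smul_apply, LieHom.coe_toLinearMap, LieAlgebra.ad_apply]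
    rw [← lie_skew x y]
    module
  metric x y z := by
    simp only [LinearMap.smul_apply, LieHom.coe_toLinearMap, LieAlgebra.ad_apply, map_smul,
      hB.invariant x y z, smul_eq_mul]
    ring

/-- By the Jacobi identity the curvature collapses to `R(x, y)z = -¼[[x, y], z]`, which as a map of
`x` is `-¼ ad z ∘ ad y`. -/
theorem ricciTensor_half_ad (y z : 𝔤) :
    ricciTensor ((1 / 2 : ℝ) • (LieAlgebra.ad ℝ 𝔤 : 𝔤 →ₗ[ℝ] 𝔤 →ₗ[ℝ] 𝔤)) y z =
      -(1 / 4) * killingForm ℝ 𝔤 y z := by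
  have h : curvatureEnd ((1 / 2 : ℝ) • (LieAlgebra.ad ℝ 𝔤 : 𝔤 →ₗ[ℝ] 𝔤 →ₗ[ℝ] 𝔤)) y z =
      (-(1 / 4) : ℝ) • (LieAlgebra.ad ℝ 𝔤 z ∘ₗ LieAlgebra.ad ℝ 𝔤 y) := by
    ext x
    change ((1 / 2 : ℝ) • ⁅x, (1 / 2 : ℝ) • ⁅y, z⁆⁆) - ((1 / 2 : ℝ) • ⁅y, (1 / 2 : ℝ) • ⁅x, z⁆⁆) -
      ((1 / 2 : ℝ) • ⁅⁅x, y⁆, z⁆) = (-(1 / 4) : ℝ) • ⁅z, ⁅y, x⁆⁆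
    have h1 : ⁅z, ⁅y, x⁆⁆ = ⁅⁅x, y⁆, z⁆ := by
      rw [← lie_skew y x, lie_neg, lie_skew]
    rw [h1, lie_smul, lie_smul, lie_lie]
    module
  rw [ricciTensor, h, map_smul, smul_eq_mul, LieModule.traceForm_comm, killingForm_apply_apply]

theorem isEinstein_iff_exists_killingForm_eq {B : LinearMap.BilinForm ℝ 𝔤}
    (hB : IsInvariantScalarProduct B) :
    IsEinstein B ↔ ∃ c : ℝ, killingForm ℝ 𝔤 = c • B := by
  constructor
  · rintro ⟨D, hD, c, hc⟩
    refine ⟨-4 * c, ?_⟩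
    ext y z
    have h := hc y z
    rw [IsLeviCivita.unique hB.symm hB.nondegenerate hD hB.isLeviCivita, ricciTensor_half_ad] at h
    simp only [LinearMap.smul_apply, smul_eq_mul]
    linarith
  · rintro ⟨c, hc⟩
    refine ⟨_, hB.isLeviCivita, -(1 / 4) * c, fun y z => ?_⟩
    rw [ricciTensor_half_ad, hc, LinearMap.smul_apply, LinearMap.smul_apply, smul_eq_mul, mul_assoc]

variable [FiniteDimensional ℝ 𝔤]

theorem isEinstein_iff_killingForm_eq_zero [LieAlgebra.IsSolvable 𝔤] {B : LinearMap.BilinForm ℝ 𝔤}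
    (hB : IsInvariantScalarProduct B) : IsEinstein B ↔ killingForm ℝ 𝔤 = 0 := by
  rw [isEinstein_iff_exists_killingForm_eq hB]
  refine ⟨?_, fun h => ⟨0, by rw [h, zero_smul]⟩⟩
  rintro ⟨c, hc⟩
  rcases eq_or_ne c 0 with rfl | hc0
  · rw [hc, zero_smul]
  have hK : LieAlgebra.IsKilling ℝ 𝔤 := by
    refine ⟨(LieSubmodule.eq_bot_iff _).2 fun x hx => hB.nondegenerate.2 x fun y => ?_⟩
    have h := (LieIdeal.mem_killingCompl ℝ 𝔤 ⊤).1 hx y (LieSubmodule.mem_top y)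
    rw [hc, LinearMap.smul_apply, LinearMap.smul_apply, smul_eq_mul] at h
    exact (mul_eq_zero.1 h).resolve_left hc0
  have hrad : (⊤ : LieIdeal ℝ 𝔤) = ⊥ := by
    rw [← LieAlgebra.radical_eq_top_of_isSolvable ℝ 𝔤, LieAlgebra.HasTrivialRadical.radical_eq_bot]
  ext x y
  have hx : x = 0 := by
    rw [← LieSubmodule.mem_bot (R := ℝ) (L := 𝔤), ← hrad]
    exact LieSubmodule.mem_top x
  simp [hx]

end LeviCivita

/-! ### Lower bounds when the Killing form vanishes -/

section Bounds

variable {𝔤 : Type*} [LieRing 𝔤] [LieAlgebra ℝ 𝔤]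

theorem lie_mem_derivedSeries_one (x y : 𝔤) : ⁅x, y⁆ ∈ LieAlgebra.derivedSeries ℝ 𝔤 1 :=
  LieSubmodule.lie_mem_lie (LieSubmodule.mem_top x) (LieSubmodule.mem_top y)

theorem mem_center_of_forall_apply_lie_eq_zero {B : LinearMap.BilinForm ℝ 𝔤}
    (hB : IsInvariantScalarProduct B) {x : 𝔤} (hx : ∀ y z : 𝔤, B ⁅y, z⁆ x = 0) :
    x ∈ LieAlgebra.center ℝ 𝔤 := by
  rw [LieModule.mem_maxTrivSubmodule]
  intro y
  refine hB.nondegenerate.2 _ fun z => ?_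
  have h := hB.invariant y z x
  rw [hx y z] at h
  linarith

variable [FiniteDimensional ℝ 𝔤]

/-- Cartan's criterion for the adjoint representation. -/
theorem isNilpotent_ad_of_mem_derivedSeries (hK : killingForm ℝ 𝔤 = 0) {x : 𝔤}
    (hx : x ∈ LieAlgebra.derivedSeries ℝ 𝔤 1) : IsNilpotent (LieAlgebra.ad ℝ 𝔤 x) :=
  (LieModule.isNilpotent_iff_forall' (R := ℝ)).1
    (LieModule.isNilpotent_derivedSeries_of_traceForm_eq_zero hK) ⟨x, hx⟩

theorem isNilpotent_derivedSeries_one (hK : killingForm ℝ 𝔤 = 0) :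
    LieRing.IsNilpotent (LieAlgebra.derivedSeries ℝ 𝔤 1) := by
  rw [LieAlgebra.isNilpotent_iff_forall (R := ℝ)]
  rintro ⟨x, hx⟩
  exact LieSubalgebra.isNilpotent_ad_of_isNilpotent_ad
    (LieAlgebra.derivedSeries ℝ 𝔤 1 : LieSubalgebra ℝ 𝔤) (x := ⟨x, hx⟩)
    (isNilpotent_ad_of_mem_derivedSeries hK hx)

theorem derivedSeries_one_sup_center_le_lieNilradical (hK : killingForm ℝ 𝔤 = 0) :
    LieAlgebra.derivedSeries ℝ 𝔤 1 ⊔ LieAlgebra.center ℝ 𝔤 ≤ lieNilradical 𝔤 := by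
  refine sup_le (le_sSup (isNilpotent_derivedSeries_one hK)) (le_sSup ?_)
  change LieRing.IsNilpotent (LieAlgebra.center ℝ 𝔤)
  infer_instance

theorem isNilpotent_ad_of_mem_sup_center (hK : killingForm ℝ 𝔤 = 0) {x : 𝔤}
    (hx : x ∈ LieAlgebra.derivedSeries ℝ 𝔤 1 ⊔ LieAlgebra.center ℝ 𝔤) :
    IsNilpotent (LieAlgebra.ad ℝ 𝔤 x) := by
  obtain ⟨d, hd, z, hz, rfl⟩ := LieSubmodule.mem_sup _ _ _ |>.1 hx
  have hz' : LieAlgebra.ad ℝ 𝔤 z = 0 := by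
    ext y
    rw [LieAlgebra.ad_apply, ← lie_skew, (LieModule.mem_maxTrivSubmodule ℝ 𝔤 𝔤 z).1 hz y, neg_zero]
    rfl
  rw [map_add, hz', add_zero]
  exact isNilpotent_ad_of_mem_derivedSeries hK hd

theorem bounds_of_killingForm_eq_zero {B : LinearMap.BilinForm ℝ 𝔤}
    (hB : IsInvariantScalarProduct B) (hK : killingForm ℝ 𝔤 = 0)
    (hnil : ¬ LieRing.IsNilpotent 𝔤) :
    6 ≤ finrank ℝ 𝔤 ∧ 5 ≤ finrank ℝ (lieNilradical 𝔤) ∧ 2 ≤ wittIndex B := by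
  rw [LieAlgebra.isNilpotent_iff_forall (R := ℝ)] at hnil
  push Not at hnil
  obtain ⟨x, hx⟩ := hnil
  have hskew : ∀ u v, B (LieAlgebra.ad ℝ 𝔤 x u) v = - B u (LieAlgebra.ad ℝ 𝔤 x v) :=
    fun u v => hB.invariant x u v
  have htr : LinearMap.trace ℝ 𝔤 (LieAlgebra.ad ℝ 𝔤 x * LieAlgebra.ad ℝ 𝔤 x) = 0 := by
    have h := killingForm_apply_apply ℝ 𝔤 x x
    rw [hK] at h
    exact h.symm
  obtain ⟨V₀, V₁, hdisj, horth, hker, hrange, h4, v, hv, hv0, hvv⟩ :=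
    exists_fitting_of_skew hB.symm hB.nondegenerate hskew hx htr
  set m : LieIdeal ℝ 𝔤 := LieAlgebra.derivedSeries ℝ 𝔤 1 ⊔ LieAlgebra.center ℝ 𝔤
  have hD : LieAlgebra.derivedSeries ℝ 𝔤 1 ≤ m := le_sup_left
  have hZ : LieAlgebra.center ℝ 𝔤 ≤ m := le_sup_right
  set j : Submodule ℝ 𝔤 := B.orthogonal m.toSubmodule
  have hjZ : ∀ w ∈ j, w ∈ LieAlgebra.center ℝ 𝔤 := fun w hw =>
    mem_center_of_forall_apply_lie_eq_zero hB fun y z => hw _ (hD (lie_mem_derivedSeries_one y z))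
  have hjV₀ : j ≤ V₀ := fun w hw =>
    hker ((LieModule.mem_maxTrivSubmodule ℝ 𝔤 𝔤 w).1 (hjZ w hw) x)
  have hjm : j ≤ m.toSubmodule := fun w hw => hZ (hjZ w hw)
  have hV₁m : V₁ ≤ m.toSubmodule := fun w hw => by
    obtain ⟨u, rfl⟩ := hrange hw
    exact hD (lie_mem_derivedSeries_one x u)
  have hmlt : finrank ℝ m.toSubmodule < finrank ℝ 𝔤 := Submodule.finrank_lt <| by
    intro h
    exact hx (isNilpotent_ad_of_mem_sup_center hK (h ▸ Submodule.mem_top : x ∈ m.toSubmodule))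
  have hjm' : finrank ℝ j = finrank ℝ 𝔤 - finrank ℝ m.toSubmodule :=
    LinearMap.BilinForm.finrank_orthogonal hB.nondegenerate _
  have hsum : finrank ℝ j + finrank ℝ V₁ ≤ finrank ℝ m.toSubmodule := by
    have h := Submodule.finrank_sup_add_finrank_inf_eq j V₁
    rw [(hdisj.mono_left hjV₀).eq_bot, finrank_bot, add_zero] at h
    rw [← h]
    exact Submodule.finrank_mono (sup_le hjm hV₁m)
  have hmn : finrank ℝ m.toSubmodule ≤ finrank ℝ (lieNilradical 𝔤) :=
    Submodule.finrank_mono (derivedSeries_one_sup_center_le_lieNilradical hK)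
  refine ⟨by omega, by omega, ?_⟩
  have hvj : Disjoint j (Submodule.span ℝ {v}) :=
    hdisj.mono hjV₀ ((Submodule.span_singleton_le_iff_mem v V₁).2 hv)
  have hW : finrank ℝ (j ⊔ Submodule.span ℝ {v} : Submodule ℝ 𝔤) = finrank ℝ j + 1 := by
    have h := Submodule.finrank_sup_add_finrank_inf_eq j (Submodule.span ℝ {v})
    rwa [hvj.eq_bot, finrank_bot, add_zero, finrank_span_singleton hv0] at h
  have hiso : IsTotallyIsotropic B (j ⊔ Submodule.span ℝ {v}) := by
    intro a ha b hb
    obtain ⟨a₁, ha₁, a₂, ha₂, rfl⟩ := Submodule.mem_sup.1 ha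
    obtain ⟨b₁, hb₁, b₂, hb₂, rfl⟩ := Submodule.mem_sup.1 hb
    obtain ⟨s, rfl⟩ := Submodule.mem_span_singleton.1 ha₂
    obtain ⟨t, rfl⟩ := Submodule.mem_span_singleton.1 hb₂
    have h1 : B a₁ b₁ = 0 := hb₁ _ (hjm ha₁)
    have h2 : B a₁ v = 0 := horth _ (hjV₀ ha₁) _ hv
    have h3 : B v b₁ = 0 := by rw [← hB.symm.eq]; exact horth _ (hjV₀ hb₁) _ hv
    simp [h1, h2, h3, hvv]
  have := (wittIndex_isGreatest B).2 ⟨_, hiso, hW⟩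
  omega

end Bounds

/-! ### The sharp six-dimensional example -/

namespace DoubleExt6

/-- The coordinates with respect to the basis `a, b, x₁, x₂, y, z`. -/
noncomputable def coord (i : Fin 6) : DoubleExt6 →ₗ[ℝ] ℝ :=
  (LinearMap.proj i : (Fin 6 → ℝ) →ₗ[ℝ] ℝ)

/-- The basis `a, b, x₁, x₂, y, z`. -/
noncomputable def basis : Basis (Fin 6) ℝ DoubleExt6 := Pi.basisFun ℝ (Fin 6)

theorem basis_repr (u : DoubleExt6) (i : Fin 6) : basis.repr u i = coord i u := rfl

theorem coord_basis (i j : Fin 6) : coord i (basis j) = if i = j then 1 else 0 := by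
  rw [← basis_repr, Basis.repr_self, Finsupp.single_apply]
  simp only [eq_comm]

theorem ext_coord {u v : DoubleExt6} (h : ∀ i, coord i u = coord i v) : u = v :=
  basis.ext_elem h

theorem coord_zero_lie (u v : DoubleExt6) : coord 0 ⁅u, v⁆ = 0 := rfl

theorem coord_one_lie (u v : DoubleExt6) :
    coord 1 ⁅u, v⁆ = coord 0 u * coord 1 v - coord 0 v * coord 1 u := rfl

theorem coord_two_lie (u v : DoubleExt6) :
    coord 2 ⁅u, v⁆ = -(coord 0 u * coord 3 v - coord 0 v * coord 3 u) := rfl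

theorem coord_three_lie (u v : DoubleExt6) :
    coord 3 ⁅u, v⁆ = coord 0 u * coord 2 v - coord 0 v * coord 2 u := rfl

theorem coord_four_lie (u v : DoubleExt6) :
    coord 4 ⁅u, v⁆ = -(coord 0 u * coord 4 v - coord 0 v * coord 4 u) := rfl

theorem coord_five_lie (u v : DoubleExt6) :
    coord 5 ⁅u, v⁆ = (coord 1 u * coord 4 v - coord 1 v * coord 4 u) +
      (coord 2 u * coord 3 v - coord 2 v * coord 3 u) := rfl

theorem form_apply (u v : DoubleExt6) :
    form u v = (coord 0 u * coord 5 v + coord 5 u * coord 0 v) +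
      (coord 1 u * coord 4 v + coord 4 u * coord 1 v) + coord 2 u * coord 2 v +
      coord 3 u * coord 3 v := rfl

theorem finrank_eq : finrank ℝ DoubleExt6 = 6 := by
  rw [finrank_eq_card_basis basis, Fintype.card_fin]

theorem isInvariantScalarProduct_form : IsInvariantScalarProduct form where
  symm := ⟨fun u v => by simp only [form_apply]; ring⟩
  nondegenerate := by
    have hs : form.IsSymm := ⟨fun u v => by simp only [form_apply]; ring⟩
    refine hs.isRefl.nondegenerate_iff_separatingLeft.2 fun u hu => ext_coord fun i => ?_
    have h0 := hu (basis 0)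
    have h1 := hu (basis 1)
    have h2 := hu (basis 2)
    have h3 := hu (basis 3)
    have h4 := hu (basis 4)
    have h5 := hu (basis 5)
    simp [form_apply, coord_basis] at h0 h1 h2 h3 h4 h5
    fin_cases i <;> simp [*]
  invariant u v w := by
    simp only [form_apply, coord_zero_lie, coord_one_lie, coord_two_lie, coord_three_lie,
      coord_four_lie, coord_five_lie]
    ring

/-- The eigenvalues `1, -1, i, -i` of `ad a` on the span of `b, x₁, x₂, y` have squares summing to
zero; the other basis vectors contribute nothing. -/
theorem killingForm_eq_zero : killingForm ℝ DoubleExt6 = 0 := by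
  ext u v
  rw [killingForm_apply_apply, LinearMap.trace_eq_matrix_trace ℝ basis, Matrix.trace,
    Fin.sum_univ_six]
  simp only [Matrix.diag_apply, LinearMap.toMatrix_apply, basis_repr, LinearMap.comp_apply,
    LieAlgebra.ad_apply, coord_zero_lie, coord_one_lie, coord_two_lie, coord_three_lie,
    coord_four_lie, coord_five_lie, coord_basis]
  simp

theorem isSolvable : LieAlgebra.IsSolvable DoubleExt6 :=
  LieAlgebra.isSolvable_of_killingForm_apply_lie_eq_zero (R := ℝ) fun x y _ => by
    rw [killingForm_eq_zero]; rfl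

theorem coord_zero_eq_zero_of_mem {I : LieIdeal ℝ DoubleExt6} (hI : LieRing.IsNilpotent I)
    {u : DoubleExt6} (hu : u ∈ I) : coord 0 u = 0 := by
  by_contra h0
  -- `b` itself need not lie in `I`, so the iteration starts at `[u, b]`, hence the exponent `k + 1`
  -- below. Each further bracket with `u` multiplies the `b`-coordinate by `coord 0 u`, so `ad u` is
  -- not nilpotent on `I`.
  have hb : ⁅u, basis 1⁆ ∈ I := lie_mem_left ℝ DoubleExt6 I u _ hu
  obtain ⟨k, hk⟩ := (LieAlgebra.isNilpotent_iff_forall (R := ℝ)).1 hI ⟨u, hu⟩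
  have hpow : ∀ k : ℕ,
      coord 0 (((LieAlgebra.ad ℝ I ⟨u, hu⟩) ^ k) ⟨_, hb⟩ : I) = 0 ∧
      coord 1 (((LieAlgebra.ad ℝ I ⟨u, hu⟩) ^ k) ⟨_, hb⟩ : I) = coord 0 u ^ (k + 1) := by
    intro k
    induction k with
    | zero => simp [coord_zero_lie, coord_one_lie, coord_basis]
    | succ k ih =>
      rw [pow_succ', Module.End.mul_apply, LieAlgebra.ad_apply]
      change coord 0 ⁅u, _⁆ = 0 ∧ coord 1 ⁅u, _⁆ = _
      rw [coord_zero_lie, coord_one_lie, ih.1, ih.2]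
      exact ⟨rfl, by ring⟩
  have h := (hpow k).2
  rw [hk] at h
  exact pow_ne_zero _ h0 h.symm

theorem not_isNilpotent : ¬ LieRing.IsNilpotent DoubleExt6 := by
  intro h
  have htop : LieRing.IsNilpotent (⊤ : LieIdeal ℝ DoubleExt6) :=
    inferInstanceAs (LieRing.IsNilpotent (⊤ : LieSubalgebra ℝ DoubleExt6))
  have := coord_zero_eq_zero_of_mem htop (LieSubmodule.mem_top (basis 0))
  simp [coord_basis] at this

theorem isEinstein_form : IsEinstein form :=
  (isEinstein_iff_exists_killingForm_eq isInvariantScalarProduct_form).2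
    ⟨0, by rw [killingForm_eq_zero, zero_smul]⟩

/-- The ideal spanned by `b, x₁, x₂, y, z`. -/
noncomputable def coordZeroIdeal : LieIdeal ℝ DoubleExt6 where
  __ := LinearMap.ker (coord 0)
  lie_mem := fun {u v} _ => coord_zero_lie u v

theorem finrank_lieNilradical_le : finrank ℝ (lieNilradical DoubleExt6) ≤ 5 := by
  have hle : lieNilradical DoubleExt6 ≤ coordZeroIdeal :=
    sSup_le fun I hI u hu => coord_zero_eq_zero_of_mem hI hu
  have hlt : finrank ℝ (lieNilradical DoubleExt6).toSubmodule < finrank ℝ DoubleExt6 := by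
    refine Submodule.finrank_lt fun h => ?_
    have h1 : basis 0 ∈ lieNilradical DoubleExt6 :=
      (h ▸ Submodule.mem_top : basis 0 ∈ (lieNilradical DoubleExt6).toSubmodule)
    have h2 : coord 0 (basis 0) = 0 := hle h1
    simp [coord_basis] at h2
  rw [finrank_eq] at hlt
  exact Nat.lt_succ_iff.1 hlt

/-- Where `coord 0 = coord 5` and `coord 1 = coord 4`, the form is the positive definite `2u₀² +
2u₁² + u₂² + u₃²`. So these two linear conditions cut an isotropic subspace down to zero. -/
theorem wittIndex_form_le : wittIndex form ≤ 2 := by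
  obtain ⟨W, hW, hd⟩ := (wittIndex_isGreatest form).1
  let f : W →ₗ[ℝ] ℝ × ℝ :=
    ((coord 0 - coord 5).prod (coord 1 - coord 4)).comp W.subtype
  have hf : Function.Injective f := by
    rw [← LinearMap.ker_eq_bot, LinearMap.ker_eq_bot']
    rintro ⟨u, hu⟩ h
    have h1 : coord 0 u - coord 5 u = 0 := congrArg Prod.fst h
    have h2 : coord 1 u - coord 4 u = 0 := congrArg Prod.snd h
    have h3 := hW u hu u hu
    rw [form_apply, ← sub_eq_zero.1 h1, ← sub_eq_zero.1 h2] at h3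
    have q0 := mul_self_nonneg (coord 0 u)
    have q1 := mul_self_nonneg (coord 1 u)
    have q2 := mul_self_nonneg (coord 2 u)
    have q3 := mul_self_nonneg (coord 3 u)
    have c0 : coord 0 u = 0 := mul_self_eq_zero.1 (by linarith)
    have c1 : coord 1 u = 0 := mul_self_eq_zero.1 (by linarith)
    have c2 : coord 2 u = 0 := mul_self_eq_zero.1 (by linarith)
    have c3 : coord 3 u = 0 := mul_self_eq_zero.1 (by linarith)
    have c4 : coord 4 u = 0 := by linarith
    have c5 : coord 5 u = 0 := by linarith
    refine Subtype.ext (ext_coord fun i => ?_)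
    fin_cases i <;> simp [*]
  have h := LinearMap.finrank_le_finrank_of_injective hf
  rw [hd, finrank_prod, finrank_self] at h
  exact h

end DoubleExt6

theorem mainTheorem2 :
    -- every solvable metric Lie algebra: the scalar product is Einstein iff the Killing form
    -- vanishes, and the lower bounds hold in the Einstein, non-nilpotent case
    (∀ (𝔤 : Type*) [LieRing 𝔤] [LieAlgebra ℝ 𝔤] [FiniteDimensional ℝ 𝔤] [LieAlgebra.IsSolvable 𝔤]
        (B : LinearMap.BilinForm ℝ 𝔤), IsInvariantScalarProduct B →
        (IsEinstein B ↔ killingForm ℝ 𝔤 = 0) ∧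
        (IsEinstein B → ¬ LieRing.IsNilpotent 𝔤 →
          6 ≤ Module.finrank ℝ 𝔤 ∧
          5 ≤ Module.finrank ℝ (lieNilradical 𝔤) ∧
          2 ≤ wittIndex B)) ∧
    -- the three bounds are attained at once by the six-dimensional double extension
    (LieAlgebra.IsSolvable DoubleExt6 ∧
      IsInvariantScalarProduct DoubleExt6.form ∧
      IsEinstein DoubleExt6.form ∧
      ¬ LieRing.IsNilpotent DoubleExt6 ∧
      Module.finrank ℝ DoubleExt6 = 6 ∧
      Module.finrank ℝ (lieNilradical DoubleExt6) = 5 ∧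
      wittIndex DoubleExt6.form = 2) := by
  refine ⟨fun 𝔤 _ _ _ _ B hB => ⟨isEinstein_iff_killingForm_eq_zero hB, fun hE hnil =>
    bounds_of_killingForm_eq_zero hB ((isEinstein_iff_killingForm_eq_zero hB).1 hE) hnil⟩, ?_⟩
  obtain ⟨-, h5, h2⟩ := bounds_of_killingForm_eq_zero DoubleExt6.isInvariantScalarProduct_form
    DoubleExt6.killingForm_eq_zero DoubleExt6.not_isNilpotent
  exact ⟨DoubleExt6.isSolvable, DoubleExt6.isInvariantScalarProduct_form,
    DoubleExt6.isEinstein_form, DoubleExt6.not_isNilpotent, DoubleExt6.finrank_eq,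
    le_antisymm DoubleExt6.finrank_lieNilradical_le h5,
    le_antisymm DoubleExt6.wittIndex_form_le h2⟩
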